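/- Let $\mathcal G$ be (the geometric realization of) a locally finite undirected graph with vertex set $V$ and at least one edge, multiple edges and self-loops allowed. Each edge $e$ has a length $\ell_e>0$ and a weight $a_e>0$; each vertex $v$ has a mass $\mathcal V(v)>0$; and $\partial\mathcal G\subset V$ is a specified (possibly empty) set of boundary vertices. Let $\mathcal V(\Omega)=\sum_{v\in V\cap\Omega}\mathcal V(v)$ and $$\rho_{\sup}=\sup_{v\in V}\ \frac{1}{\mathcal V(v)}\sum_{e\ni v}\frac{a_e\ell_e}{2},$$ and assume $\rho_{\sup}<\infty$. Call $\Omega\subset\mathcal G$ admissible if it is open, has finite topological boundary $\partial\Omega$, and is disjoint from $\partial\mathcal G$. Let $\mathcal A(\partial\Omega)$ be the sum of $a_e$ over the points of $\partial\Omega$ in edge interiors ($e$ being the edge that contains the point), plus, for each vertex $v\in\partial\Omega$, the sum of $a_e$ over the edges $e$ such that $v$ lies in the closure of the intersection of $\Omega$ with the interior of $e$. For functions on vertices let $(\Delta f)(v)=\mathcal V(v)^{-1}\sum_{e\sim\{u,v\}}\frac{a_e}{\ell_e}(f(v)-f(u))$. A fundamental solution is a function $K(x,y,t)$, $x,y\in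 V$, $t\ge 0$ (extended edgewise linearly in $x$ and $y$), that vanishes if $x$ or $y$ is in $\partial\mathcal G$, is continuous in $t\ge0$, and satisfies, for $x,y\notin\partial\mathcal G$, $K(x,y,0)=1/\mathcal V(y)$ if $x=y$ and $0$ otherwise, and $\partial_tK=-\Delta_xK$ for $t>0$. It is a heat kernel if it is symmetric in $x,y$, satisfies $K(x,y,t)=\sum_{s\in V}K(x,s,\tau)K(s,y,t-\tau)\mathcal V(s)$ for $0\le\tau\le t$, and this identity may be differentiated in $t$ term by term for $0\le\tau<t$. The minimal heat kernel is the non-negative heat kernel that is pointwise at most every non-negative fundamental solution. Let $\phi$ be a positive nondecreasing function on $(0,\infty)$ for which the integral $$F(x)=\int_x^\infty\frac{\phi(4/u)^2}{u}\,du$$ converges for all $x>0$, and suppose that $$\mathcal A(\partial\Omega)\ \ge\ \frac{\mathcal V(\Omega)}{\phi(\mathcal V(\Omega))}$$ for all admissible $\Omega$ with $0<\mathcal V(\Omega)<\infty$. Then $F$ is a bijection of $(0,\infty)$ onto itself, the minimal heat kernel $K$ of $\mathcal G$ exists, and for all $x\in V$ and $t>0$, $$K(x,x,t)\ \le\ F^{-1}\!\left(\frac{t}{32\,\rho_{\sup}}\right).$$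 -/

import Mathlib

open Set Filter Topology
open scoped ENNReal

/-- A locally finite undirected graph with vertex set `V` and edge set `E` (self-loops and multiple
edges are allowed), with edge lengths `len e`, a vertex measure `vol`, an edge measure equal to
`wt e` times Lebesgue measure on the edge `e`, and a specified set `bdry` of boundary vertices.
The endpoints of `e` are `src e` and `tgt e`; the resulting orientation only serves to
parametrize the edge, and nothing below depends on it. -/
structure MetricGraph (V E : Type*) where
  src : E → V
  tgt : E → V
  len : E → ℝ
  len_pos : ∀ e, 0 < len e
  wt : E → ℝ
  wt_pos : ∀ e, 0 < wt e
  vol : V → ℝ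
  vol_pos : ∀ v, 0 < vol v
  bdry : Set V
  locally_finite : ∀ v, {e | src e = v ∨ tgt e = v}.Finite

namespace MetricGraph

noncomputable section

variable {V E : Type*} (G : MetricGraph V E)

/-- The finite set of edges that have `v` as an endpoint. -/
def incident (v : V) : Finset E := (G.locally_finite v).toFinset

/-- The total edge measure of the edge `e`. -/
def edgeMeasure (e : E) : ℝ := G.wt e * G.len e

/-- The half-degree of a vertex. -/
def halfDegree (v : V) : ℝ := (∑ e ∈ G.incident v, G.edgeMeasure e / 2) / G.vol v

/-- The supremum of the half-degrees. -/
def rhoSup : ℝ := ⨆ v, G.halfDegree v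

/-! ### The geometric realization -/

/-- The points of the geometric realization: the vertices, and for each edge `e` the points of an
open interval of length `len e`. -/
inductive Point (G : MetricGraph V E) : Type _
  | vertex (v : V) : Point G
  | inner (e : E) (s : Ioo (0 : ℝ) (G.len e)) : Point G

open Classical in
/-- The parametrization of the closed edge `e` by `[0, len e]`, from `src e` to `tgt e`. -/
def path (e : E) (s : Icc (0 : ℝ) (G.len e)) : G.Point :=
  if h : 0 < (s : ℝ) ∧ (s : ℝ) < G.len e then Point.inner e ⟨s, h⟩
  else if (s : ℝ) = 0 then Point.vertex (G.src e) else Point.vertex (G.tgt e)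

/-- A set is open iff its trace on each closed edge is open. As the graph is locally finite, this
is the topology of the path metric. -/
instance : TopologicalSpace G.Point :=
  ⨆ e, TopologicalSpace.coinduced (G.path e) inferInstance

/-- The interior of the edge `e`. -/
def edgeInterior (e : E) : Set G.Point := range (Point.inner e)

/-- The vertex measure of a set of points. -/
def volume (Ω : Set G.Point) : ℝ≥0∞ :=
  ∑' v : {v : V // Point.vertex v ∈ Ω}, ENNReal.ofReal (G.vol v)

/-- The contribution of a point of the topological boundary of `Ω` to the area of that boundary:
`a_e` for a point in the interior of the edge `e`; for a vertex `v`, the sum of the `a_e` over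
those `e` for which `v` lies in the closure of the part of `Ω` in the interior of `e`. -/
def pointArea (Ω : Set G.Point) : G.Point → ℝ≥0∞
  | Point.inner e _ => ENNReal.ofReal (G.wt e)
  | Point.vertex v =>
      ∑' e : {e : E // Point.vertex v ∈ closure (Ω ∩ G.edgeInterior e)}, ENNReal.ofReal (G.wt e)

/-- The area of the topological boundary of `Ω`. -/
def boundaryArea (Ω : Set G.Point) : ℝ≥0∞ :=
  ∑' p : {p : G.Point // p ∈ frontier Ω}, G.pointArea Ω p

/-- Admissible sets: open, with finite topological boundary, and disjoint from the boundary of the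
graph. -/
def Admissible (Ω : Set G.Point) : Prop :=
  IsOpen Ω ∧ (frontier Ω).Finite ∧ ∀ v ∈ G.bdry, Point.vertex v ∉ Ω

/-- The isoperimetric inequality `𝒜(∂Ω) ≥ 𝒱(Ω) / φ(𝒱(Ω))` for all admissible `Ω`. As `φ` is a
function on `(0, ∞)`, it concerns the `Ω` with `0 < 𝒱(Ω) < ∞`. -/
def Isoperimetric (φ : ℝ → ℝ) : Prop :=
  ∀ Ω : Set G.Point, G.Admissible Ω → G.volume Ω ≠ 0 → G.volume Ω ≠ ∞ →
    ENNReal.ofReal ((G.volume Ω).toReal / φ (G.volume Ω).toReal) ≤ G.boundaryArea Ω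

/-! ### The heat equation

The functions here are edgewise linear on the geometric realization, so they are given by their
values at the vertices. Such a function of `x` and `t` is continuous in `(x, t)` iff it is
continuous in `t` at each vertex, and one such function is bounded by another iff it is so at
the vertices. Only times `t ≥ 0` matter. -/

open Classical in
/-- The (positive semidefinite) Laplacian
`(Δf)(v) = 𝒱(v)⁻¹ ∑_{e ∼ {u, v}} (a_e / ℓ_e) (f(v) - f(u))`. Here the other endpoint `u` of
an edge `e` at `v` is `tgt e` or `src e`; self-loops contribute `0`. -/
def laplacian (f : V → ℝ) (v : V) : ℝ :=
  (∑ e ∈ G.incident v,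
    G.wt e / G.len e * (f v - f (if G.src e = v then G.tgt e else G.src e))) / G.vol v

open Classical in
/-- The analogue of the Dirac delta function at `y`. -/
def delta (y x : V) : ℝ := if x = y then 1 / G.vol y else 0

/-- `u` solves the Dirichlet initial value problem on `[0, ∞)` with initial value `f`. -/
structure IsDirichletSolution (f : V → ℝ) (u : V → ℝ → ℝ) : Prop where
  continuousOn : ∀ x, ContinuousOn (u x) (Ici 0)
  heat : ∀ x ∉ G.bdry, ∀ t > 0, HasDerivAt (u x) (-G.laplacian (fun z => u z t) x) t
  initial : ∀ x ∉ G.bdry, u x 0 = f x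
  boundary : ∀ x ∈ G.bdry, ∀ t ≥ 0, u x t = 0

/-- Fundamental solutions `K x y t` of the heat equation. -/
structure IsFundamentalSolution (K : V → V → ℝ → ℝ) : Prop where
  solution : ∀ y ∉ G.bdry, G.IsDirichletSolution (G.delta y) (fun x t => K x y t)
  boundary : ∀ y ∈ G.bdry, ∀ x, ∀ t ≥ 0, K x y t = 0

/-- Heat kernels: symmetric, self-reproducing fundamental solutions for which the self-reproducing
identity may be differentiated in `t` under the integral sign. -/
structure IsHeatKernel (K : V → V → ℝ → ℝ) : Prop extends G.IsFundamentalSolution K where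
  symm : ∀ x y, ∀ t ≥ 0, K x y t = K y x t
  self_reproducing : ∀ x y τ t, 0 ≤ τ → τ ≤ t →
    HasSum (fun s => K x s τ * K s y (t - τ) * G.vol s) (K x y t)
  deriv_self_reproducing : ∀ x y τ t, 0 ≤ τ → τ < t →
    HasSum (fun s => K x s τ * deriv (K s y) (t - τ) * G.vol s) (deriv (K x y) t)

/-- The minimal non-negative heat kernel (its values for `t ≥ 0` are unique). -/
structure IsMinimalHeatKernel (K : V → V → ℝ → ℝ) : Prop extends G.IsHeatKernel K where
  nonneg : ∀ x y, ∀ t ≥ 0, 0 ≤ K x y t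
  minimal : ∀ H : V → V → ℝ → ℝ, G.IsFundamentalSolution H →
    (∀ x y, ∀ t ≥ 0, 0 ≤ H x y t) → ∀ x y, ∀ t ≥ 0, K x y t ≤ H x y t

end

end MetricGraph

/-- `F(x) = ∫_x^∞ φ(4/u)² / u du`. -/
noncomputable def decayIntegral (φ : ℝ → ℝ) (x : ℝ) : ℝ := ∫ u in Ioi x, φ (4 / u) ^ 2 / u

namespace MetricGraph

noncomputable section

variable {V E : Type*} (G : MetricGraph V E)

/-! ### Isoperimetric inequality for finite sets of vertices -/

/-! This is Nash's method: isoperimetry gives a Faber-Krahn inequality, then a Nash inequality, then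
on-diagonal decay of the kernel.

Fattening a finite vertex set `S` by half-edges gives an admissible set whose boundary consists of
midpoints of cut edges, so the hypothesis bounds the cut weight of `S` from below
(`Isoperimetric.vol_div_le`). Summing over superlevel sets turns this into an `L¹` gradient bound
(`Isoperimetric.sum_div_le`). Applied to `f²` with Cauchy-Schwarz, where `rhoSup` enters, it yields
`‖f‖² ≤ 4ρ φ(m)² · energy` for `f` supported on volume at most `m` (`Isoperimetric.sum_sq_le`).
Truncation removes the support condition: if `‖f‖₁ ≤ 1` and `N = ‖f‖²`, then `N ≤ 8ρ φ(4/N)² ·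
energy` (`Isoperimetric.nash`).

The minimal heat kernel is the supremum of the Dirichlet kernels of finite sets of interior
vertices. For such a kernel `p`, the function `u(s) = ‖p(x,·,s)‖² = p(x,x,2s)` satisfies `u' = -2 ·
energy`, so Nash gives `φ(4/u)²/u · u' ≤ -1/(4ρ)`. Integration gives `F(p(x,x,t)) ≥ t/(8ρ)`,
uniformly in the finite set. This is stronger than the constant 32 requires, as `F` is decreasing.
-/

lemma mem_incident {v : V} {e : E} : e ∈ G.incident v ↔ G.src e = v ∨ G.tgt e = v := by
  simp [incident]

/-- The predicate defining `region`. -/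
def InRegion (S : Set V) : G.Point → Prop
  | Point.vertex v => v ∈ S
  | Point.inner e s => ((s : ℝ) < G.len e / 2 ∧ G.src e ∈ S) ∨
      (G.len e / 2 < (s : ℝ) ∧ G.tgt e ∈ S) ∨ (G.src e ∈ S ∧ G.tgt e ∈ S)

/-- The open neighbourhood of a set of vertices that consists of these vertices, the edges between
them, and half of each edge that joins one of them to another vertex. -/
def region (S : Set V) : Set G.Point := {p | G.InRegion S p}

lemma preimage_path_region (S : Set V) (e : E) :
    G.path e ⁻¹' G.region S = {s : Icc (0 : ℝ) (G.len e) | ((s : ℝ) < G.len e / 2 ∧ G.src e ∈ S) ∨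
      (G.len e / 2 < (s : ℝ) ∧ G.tgt e ∈ S) ∨ (G.src e ∈ S ∧ G.tgt e ∈ S)} := by
  ext ⟨s, hs0, hs1⟩
  have hl := G.len_pos e
  by_cases h : 0 < s ∧ s < G.len e
  · simp [path, h, region, InRegion]
  · by_cases h0 : s = 0
    · subst h0
      have h2 : ¬ G.len e / 2 < 0 := by linarith
      have h3 : (0 : ℝ) < G.len e / 2 := by linarith
      simp only [mem_preimage, path, lt_irrefl, false_and, dite_false, if_true, region, InRegion,
        mem_ofPred_eq, h2, h3, true_and, false_or]
      tauto
    · have h1 : s = G.len e := by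
        rcases lt_or_eq_of_le hs1 with h1 | h1
        · exact absurd ⟨lt_of_le_of_ne hs0 (Ne.symm h0), h1⟩ h
        · exact h1
      subst h1
      have h2 : ¬ G.len e < G.len e / 2 := by linarith
      have h3 : G.len e / 2 < G.len e := by linarith
      simp only [mem_preimage, path, lt_irrefl, and_false, dite_false, h0, if_false, region,
        InRegion, mem_ofPred_eq, h2, h3, true_and, false_and, false_or]
      tauto

lemma isOpen_region (S : Set V) : IsOpen (G.region S) := by
  refine isOpen_iSup_iff.2 fun e => isOpen_coinduced.2 ?_
  rw [preimage_path_region]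
  have hc : Continuous fun s : Icc (0 : ℝ) (G.len e) => (s : ℝ) := continuous_subtype_val
  exact (IsOpen.and (isOpen_lt hc continuous_const) isOpen_const).union
    ((IsOpen.and (isOpen_lt continuous_const hc) isOpen_const).union isOpen_const)

/-- The midpoint of an edge. -/
def midpoint (e : E) : G.Point :=
  Point.inner e ⟨G.len e / 2, half_pos (G.len_pos e), half_lt_self (G.len_pos e)⟩

lemma midpoint_injective : Function.Injective G.midpoint := by
  intro e e' h
  simp only [midpoint, Point.inner.injEq] at h
  exact h.1

/-- `region S` and `region Sᶜ` are disjoint open sets, and the only points in neither are the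
midpoints of edges that join `S` to its complement. -/
lemma frontier_region_subset (S : Set V) :
    frontier (G.region S) ⊆ G.midpoint '' {e | ¬(G.src e ∈ S ↔ G.tgt e ∈ S)} := by
  intro p hp
  rw [(G.isOpen_region S).frontier_eq] at hp
  have hp' : p ∉ G.region Sᶜ := by
    intro h
    obtain ⟨q, hq, hq'⟩ := mem_closure_iff.1 hp.1 _ (G.isOpen_region Sᶜ) h
    rcases q with v | ⟨e, s⟩
    · exact hq hq'
    · simp only [region, InRegion, mem_ofPred_eq, mem_compl_iff] at hq hq'
      rcases hq with h1 | h1 | h1 <;> rcases hq' with h2 | h2 | h2 <;>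
        first
          | tauto
          | linarith [h1.1, h2.1]
  have hp2 := hp.2
  rcases p with v | ⟨e, s⟩
  · simp only [region, InRegion, mem_ofPred_eq, mem_compl_iff] at hp' hp2
    tauto
  · simp only [region, InRegion, mem_ofPred_eq, mem_compl_iff] at hp' hp2
    rcases lt_trichotomy (s : ℝ) (G.len e / 2) with h | h | h
    · tauto
    · refine ⟨e, ?_, ?_⟩
      · simp only [mem_ofPred_eq]
        tauto
      · simp only [midpoint, Point.inner.injEq, heq_eq_eq, true_and]
        exact Subtype.ext h.symm
    · tauto

open Classical in
/-- The edges with at least one endpoint in `S`. -/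
def edgesOf (S : Finset V) : Finset E := S.biUnion G.incident

lemma mem_edgesOf {S : Finset V} {e : E} : e ∈ G.edgesOf S ↔ G.src e ∈ S ∨ G.tgt e ∈ S := by
  simp only [edgesOf, Finset.mem_biUnion, mem_incident]
  constructor
  · rintro ⟨v, hv, rfl | rfl⟩ <;> tauto
  · rintro (h | h)
    · exact ⟨_, h, Or.inl rfl⟩
    · exact ⟨_, h, Or.inr rfl⟩

lemma volume_region (S : Finset V) :
    G.volume (G.region S) = ENNReal.ofReal (∑ v ∈ S, G.vol v) := by
  rw [ENNReal.ofReal_sum_of_nonneg fun v _ => (G.vol_pos v).le]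
  exact Finset.tsum_subtype S fun v => ENNReal.ofReal (G.vol v)

open Classical in
lemma boundaryArea_region_le (S : Finset V) :
    G.boundaryArea (G.region S) ≤ ENNReal.ofReal
      (∑ e ∈ G.edgesOf S with ¬(G.src e ∈ S ↔ G.tgt e ∈ S), G.wt e) := by
  set C := (G.edgesOf S).filter fun e => ¬(G.src e ∈ S ↔ G.tgt e ∈ S) with hC
  have hsub : frontier (G.region S) ⊆ ↑(C.image G.midpoint) := by
    intro p hp
    obtain ⟨e, he, rfl⟩ := G.frontier_region_subset S hp
    simp only [Finset.coe_image]
    refine ⟨e, ?_, rfl⟩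
    simp only [mem_ofPred_eq, Finset.mem_coe] at he
    simp only [hC, Finset.coe_filter, mem_ofPred_eq, mem_edgesOf]
    tauto
  calc G.boundaryArea (G.region S)
      ≤ ∑' p : (↑(C.image G.midpoint) : Set G.Point), G.pointArea (G.region S) p :=
        ENNReal.tsum_mono_subtype _ hsub
    _ = ∑ p ∈ C.image G.midpoint, G.pointArea (G.region S) p :=
        Finset.tsum_subtype _ fun p => G.pointArea (G.region S) p
    _ = ∑ e ∈ C, ENNReal.ofReal (G.wt e) := by
        -- At a midpoint `pointArea` is by definition the weight of the edge; the vertex case never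
        -- occurs.
        rw [Finset.sum_image fun _ _ _ _ h => G.midpoint_injective h]
        rfl
    _ = _ := (ENNReal.ofReal_sum_of_nonneg fun e _ => (G.wt_pos e).le).symm

variable {G}

open Classical in
-- The hypothesis is tested on `region S`. This is its only use; everything later is discrete.
lemma Isoperimetric.vol_div_le {φ : ℝ → ℝ} (hiso : G.Isoperimetric φ) {S : Finset V}
    (hS : S.Nonempty) (hb : ∀ v ∈ S, v ∉ G.bdry) :
    (∑ v ∈ S, G.vol v) / φ (∑ v ∈ S, G.vol v) ≤
      ∑ e ∈ G.edgesOf S with ¬(G.src e ∈ S ↔ G.tgt e ∈ S), G.wt e := by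
  have hpos : 0 < ∑ v ∈ S, G.vol v := Finset.sum_pos (fun v _ => G.vol_pos v) hS
  have hadm : G.Admissible (G.region S) := by
    refine ⟨G.isOpen_region S, ?_, fun v hv hvS => hb v hvS hv⟩
    refine Set.Finite.subset (Set.Finite.image _ ?_) (G.frontier_region_subset S)
    refine (G.edgesOf S).finite_toSet.subset fun e he => ?_
    simp only [mem_ofPred_eq, Finset.mem_coe, mem_edgesOf] at he ⊢
    tauto
  have h := (hiso _ hadm (by rw [volume_region]; simpa using hpos)
    (by rw [volume_region]; exact ENNReal.ofReal_ne_top)).trans (G.boundaryArea_region_le S)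
  rw [volume_region, ENNReal.toReal_ofReal hpos.le] at h
  exact (ENNReal.ofReal_le_ofReal_iff (Finset.sum_nonneg fun e _ => (G.wt_pos e).le)).1 h

end

noncomputable section

variable {V E : Type*} (G : MetricGraph V E)

/-! ### Green's formula -/

lemma laplacian_mul_vol (f : V → ℝ) (v : V) :
    G.laplacian f v * G.vol v = ∑ e ∈ G.incident v,
      G.wt e / G.len e * (f v - f (open Classical in if G.src e = v then G.tgt e else G.src e)) :=
  div_mul_cancel₀ _ (G.vol_pos v).ne'

open Classical in
lemma sum_incident_eq {S : Finset V} {v : V} (hv : v ∈ S) (F : E → ℝ) :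
    ∑ e ∈ G.incident v, F e =
      ∑ e ∈ G.edgesOf S, if G.src e = v ∨ G.tgt e = v then F e else 0 := by
  rw [← Finset.sum_filter]
  refine Finset.sum_congr ?_ fun _ _ => rfl
  ext e
  simp only [mem_incident, Finset.mem_filter, mem_edgesOf]
  constructor
  · rintro (rfl | rfl) <;> tauto
  · tauto

open Classical in
/-- The sum over `S` of a function on the endpoints of `e`, where `e` is not a loop. -/
lemma sum_endpoints {S : Finset V} {e : E} (he : G.src e ≠ G.tgt e) {F : V → ℝ}
    (hF : ∀ v ∉ S, F v = 0) :
    (∑ v ∈ S, if G.src e = v ∨ G.tgt e = v then F v else 0) = F (G.src e) + F (G.tgt e) := by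
  have h : ∀ v ∈ S, (if G.src e = v ∨ G.tgt e = v then F v else 0) =
      (if G.src e = v then F v else 0) + (if G.tgt e = v then F v else 0) := by
    intro v _
    by_cases h1 : G.src e = v
    · have h2 : G.tgt e ≠ v := fun h => he (h1.trans h.symm)
      simp [h1, h2]
    · simp [h1]
  rw [Finset.sum_congr rfl h, Finset.sum_add_distrib, Finset.sum_ite_eq, Finset.sum_ite_eq]
  congr 1 <;> split_ifs with h <;> first | rfl | exact (hF _ h).symm

/-- Green's formula for a function `g` that vanishes outside of a finite set. -/
lemma sum_mul_laplacian {S : Finset V} (f : V → ℝ) {g : V → ℝ} (hg : ∀ v ∉ S, g v = 0) :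
    ∑ v ∈ S, g v * G.laplacian f v * G.vol v = ∑ e ∈ G.edgesOf S, G.wt e / G.len e *
      ((f (G.src e) - f (G.tgt e)) * (g (G.src e) - g (G.tgt e))) := by
  classical
  have h : ∀ v ∈ S, g v * G.laplacian f v * G.vol v = ∑ e ∈ G.edgesOf S,
      if G.src e = v ∨ G.tgt e = v then g v * (G.wt e / G.len e *
        (f v - f (if G.src e = v then G.tgt e else G.src e))) else 0 := by
    intro v hv
    rw [mul_assoc, laplacian_mul_vol, Finset.mul_sum, G.sum_incident_eq hv]
  rw [Finset.sum_congr rfl h, Finset.sum_comm]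
  refine Finset.sum_congr rfl fun e _ => ?_
  -- A loop contributes zero on both sides, since its other endpoint is the vertex itself.
  by_cases he : G.src e = G.tgt e
  · rw [he, sub_self, zero_mul, mul_zero]
    refine Finset.sum_eq_zero fun v _ => ?_
    split_ifs with h1 h2
    · rw [h2, sub_self, mul_zero, mul_zero]
    · tauto
    · rfl
  · rw [G.sum_endpoints he fun v hv => by rw [hg v hv, zero_mul]]
    rw [if_pos rfl, if_neg he]
    ring

/-- The Dirichlet energy of a function that vanishes outside of the finite set `S`. -/
def energy (S : Finset V) (f : V → ℝ) : ℝ :=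
  ∑ e ∈ G.edgesOf S, G.wt e / G.len e * (f (G.src e) - f (G.tgt e)) ^ 2

lemma energy_nonneg (S : Finset V) (f : V → ℝ) : 0 ≤ G.energy S f :=
  Finset.sum_nonneg fun e _ =>
    mul_nonneg (div_pos (G.wt_pos e) (G.len_pos e)).le (sq_nonneg _)

lemma sum_self_mul_laplacian {S : Finset V} {f : V → ℝ} (hf : ∀ v ∉ S, f v = 0) :
    ∑ v ∈ S, f v * G.laplacian f v * G.vol v = G.energy S f := by
  rw [G.sum_mul_laplacian f hf]
  exact Finset.sum_congr rfl fun e _ => by ring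

lemma sum_mul_laplacian_comm {S : Finset V} {f g : V → ℝ} (hf : ∀ v ∉ S, f v = 0)
    (hg : ∀ v ∉ S, g v = 0) :
    ∑ v ∈ S, g v * G.laplacian f v * G.vol v = ∑ v ∈ S, f v * G.laplacian g v * G.vol v := by
  rw [G.sum_mul_laplacian f hg, G.sum_mul_laplacian g hf]
  exact Finset.sum_congr rfl fun e _ => by ring

/-! ### The half-degree -/

lemma edgeMeasure_pos (e : E) : 0 < G.edgeMeasure e := mul_pos (G.wt_pos e) (G.len_pos e)

lemma halfDegree_nonneg (v : V) : 0 ≤ G.halfDegree v :=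
  div_nonneg (Finset.sum_nonneg fun e _ =>
    (half_pos (G.edgeMeasure_pos e)).le) (G.vol_pos v).le

variable {G} in
lemma rhoSup_pos [Nonempty E] (hρ : BddAbove (range G.halfDegree)) : 0 < G.rhoSup := by
  obtain ⟨e⟩ := ‹Nonempty E›
  refine lt_of_lt_of_le ?_ (le_ciSup hρ (G.src e))
  refine div_pos (Finset.sum_pos (fun e _ =>
    half_pos (G.edgeMeasure_pos e)) ⟨e, ?_⟩) (G.vol_pos _)
  exact G.mem_incident.2 (Or.inl rfl)

variable {G} in
lemma sum_edgeMeasure_le (hρ : BddAbove (range G.halfDegree)) (v : V) :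
    ∑ e ∈ G.incident v, G.edgeMeasure e ≤ 2 * G.rhoSup * G.vol v := by
  have h : G.halfDegree v ≤ G.rhoSup := le_ciSup hρ v
  rw [halfDegree, div_le_iff₀ (G.vol_pos v), ← Finset.sum_div] at h
  linarith

variable {G} in
open Classical in
-- `(a + b)² ≤ 2a² + 2b²`, regrouped by vertices. Loops are left out because they occur once in
-- `incident` but have both ends at the same vertex, which would spoil the constant; they carry no
-- gradient anyway.
lemma sum_edgeMeasure_mul_le (hρ : BddAbove (range G.halfDegree)) {S : Finset V} {f : V → ℝ}
    (hf : ∀ v ∉ S, f v = 0) :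
    (∑ e ∈ G.edgesOf S, if G.src e = G.tgt e then 0 else
      G.edgeMeasure e * (f (G.src e) + f (G.tgt e)) ^ 2) ≤
      4 * G.rhoSup * ∑ v ∈ S, f v ^ 2 * G.vol v := by
  classical
  have hμ := G.edgeMeasure_pos
  have h1 : (∑ e ∈ G.edgesOf S, if G.src e = G.tgt e then 0 else
      G.edgeMeasure e * (f (G.src e) + f (G.tgt e)) ^ 2) ≤
      ∑ e ∈ G.edgesOf S, ∑ v ∈ S,
        if G.src e = v ∨ G.tgt e = v then 2 * f v ^ 2 * G.edgeMeasure e else 0 := by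
    refine Finset.sum_le_sum fun e _ => ?_
    split_ifs with he
    · refine Finset.sum_nonneg fun v _ => ?_
      have := (hμ e).le
      split_ifs <;> positivity
    · rw [G.sum_endpoints he fun v hv => by simp [hf v hv]]
      nlinarith [hμ e, mul_nonneg (hμ e).le (sq_nonneg (f (G.src e) - f (G.tgt e)))]
  refine h1.trans ?_
  rw [Finset.sum_comm, Finset.mul_sum]
  refine Finset.sum_le_sum fun v hv => ?_
  rw [← G.sum_incident_eq hv, ← Finset.mul_sum]
  have := mul_le_mul_of_nonneg_left (sum_edgeMeasure_le hρ v) (by positivity : 0 ≤ 2 * f v ^ 2)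
  linarith

/-! ### Functional inequalities -/

variable {G} {φ : ℝ → ℝ}

/-- The discrete coarea inequality. -/
lemma Isoperimetric.sum_div_le (hiso : G.Isoperimetric φ) (hφ_pos : ∀ x > 0, 0 < φ x)
    (hφ_mono : MonotoneOn φ (Ioi 0)) {m : ℝ} (hm : 0 < m) (S : Finset V) :
    (∀ v ∈ S, v ∉ G.bdry) → ∑ v ∈ S, G.vol v ≤ m → ∀ g : V → ℝ, (∀ v, 0 ≤ g v) →
      (∀ v ∉ S, g v = 0) → ∀ T : Finset V, S ⊆ T → (∑ v ∈ S, g v * G.vol v) / φ m ≤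
        ∑ e ∈ G.edgesOf T, G.wt e * |g (G.src e) - g (G.tgt e)| := by
  classical
  induction S using Finset.strongInduction with
  | H S ih =>
    intro hb hSm g hg0 hgS T hST
    rcases S.eq_empty_or_nonempty with rfl | hne
    · rw [Finset.sum_empty, zero_div]
      exact Finset.sum_nonneg fun e _ => mul_nonneg (G.wt_pos e).le (abs_nonneg _)
    -- Peel off the lowest layer: on `S`, `g = g' + g w`, with `g'` supported on `S.erase w`. The
    -- layer adds `g w` times the volume of `S` on the left and `g w` times its cut weight on the
    -- right. Keeping `T` fixed keeps the edge sum the same throughout the induction.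
    obtain ⟨w, hw, hmin⟩ := S.exists_min_image g hne
    set g' : V → ℝ := fun v => if v ∈ S then g v - g w else 0 with hg'
    have hvol : 0 < ∑ v ∈ S, G.vol v := Finset.sum_pos (fun v _ => G.vol_pos v) hne
    have hS' : ∑ v ∈ S.erase w, G.vol v ≤ m := (Finset.sum_le_sum_of_subset_of_nonneg
      (S.erase_subset w) fun v _ _ => (G.vol_pos v).le).trans hSm
    have hg'0 : ∀ v, 0 ≤ g' v := by
      intro v
      simp only [hg']
      split_ifs with h
      · exact sub_nonneg.2 (hmin v h)
      · exact le_rfl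
    have hg'S : ∀ v ∉ S.erase w, g' v = 0 := by
      intro v hv
      simp only [hg']
      split_ifs with h
      · have : v = w := by
          by_contra hvw
          exact hv (Finset.mem_erase.2 ⟨hvw, h⟩)
        rw [this, sub_self]
      · rfl
    have key := ih (S.erase w) (Finset.erase_ssubset hw)
      (fun v hv => hb v (Finset.mem_of_mem_erase hv)) hS' g' hg'0 hg'S T
      ((S.erase_subset w).trans hST)
    have hsum : ∑ v ∈ S, g v * G.vol v =
        ∑ v ∈ S.erase w, g' v * G.vol v + g w * ∑ v ∈ S, G.vol v := by
      have : ∑ v ∈ S.erase w, g' v * G.vol v = ∑ v ∈ S, g' v * G.vol v :=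
        Finset.sum_subset (S.erase_subset w) fun v _ hv => by rw [hg'S v hv, zero_mul]
      rw [this, Finset.mul_sum, ← Finset.sum_add_distrib]
      refine Finset.sum_congr rfl fun v hv => ?_
      simp only [hg', if_pos hv]
      ring
    have hedge : ∀ e, G.wt e * |g (G.src e) - g (G.tgt e)| =
        G.wt e * |g' (G.src e) - g' (G.tgt e)| +
          if ¬(G.src e ∈ S ↔ G.tgt e ∈ S) then g w * G.wt e else 0 := by
      intro e
      simp only [hg']
      have hw0 := hg0 w
      by_cases h1 : G.src e ∈ S <;> by_cases h2 : G.tgt e ∈ S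
      · simp [h1, h2]
      · have := hmin _ h1
        simp only [h1, h2, hgS _ h2, if_true, if_false, sub_zero, iff_false, not_true,
          not_false_eq_true]
        rw [abs_of_nonneg (hg0 _), abs_of_nonneg (sub_nonneg.2 this)]
        ring
      · have := hmin _ h2
        simp only [h1, h2, hgS _ h1, if_true, if_false, zero_sub, iff_true,
          not_false_eq_true, abs_neg]
        rw [abs_of_nonneg (hg0 _), abs_of_nonneg (sub_nonneg.2 this)]
        ring
      · simp [h1, h2, hgS _ h1, hgS _ h2]
    have hcross : ∑ e ∈ G.edgesOf S with ¬(G.src e ∈ S ↔ G.tgt e ∈ S), G.wt e ≤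
        ∑ e ∈ G.edgesOf T with ¬(G.src e ∈ S ↔ G.tgt e ∈ S), G.wt e := by
      refine Finset.sum_le_sum_of_subset_of_nonneg (Finset.filter_subset_filter _ fun e he => ?_)
        fun e _ _ => (G.wt_pos e).le
      rw [mem_edgesOf] at he ⊢
      exact he.imp (@hST _) (@hST _)
    -- Monotonicity of `φ` allows the same denominator `φ m` for all layers.
    have hiso' : (∑ v ∈ S, G.vol v) / φ m ≤
        ∑ e ∈ G.edgesOf T with ¬(G.src e ∈ S ↔ G.tgt e ∈ S), G.wt e :=
      (div_le_div_of_nonneg_left hvol.le (hφ_pos _ hvol) (hφ_mono hvol hm hSm)).trans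
        ((hiso.vol_div_le hne hb).trans hcross)
    rw [Finset.sum_congr rfl fun e _ => hedge e, Finset.sum_add_distrib, ← Finset.sum_filter,
      ← Finset.mul_sum, hsum, add_div, mul_div_assoc]
    exact add_le_add key (mul_le_mul_of_nonneg_left hiso' (hg0 w))

/-- The Faber-Krahn inequality. -/
lemma Isoperimetric.sum_sq_le (hiso : G.Isoperimetric φ) (hφ_pos : ∀ x > 0, 0 < φ x)
    (hφ_mono : MonotoneOn φ (Ioi 0)) (hρ : BddAbove (range G.halfDegree)) {m : ℝ} (hm : 0 < m)
    {S T : Finset V} (hb : ∀ v ∈ S, v ∉ G.bdry) (hSm : ∑ v ∈ S, G.vol v ≤ m) (hST : S ⊆ T)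
    {f : V → ℝ} (hf : ∀ v ∉ S, f v = 0) :
    ∑ v ∈ S, f v ^ 2 * G.vol v ≤ 4 * G.rhoSup * φ m ^ 2 * G.energy T f := by
  classical
  set N := ∑ v ∈ S, f v ^ 2 * G.vol v with hN
  have hN0 : 0 ≤ N := Finset.sum_nonneg fun v _ => mul_nonneg (sq_nonneg _) (G.vol_pos v).le
  have hφ := hφ_pos m hm
  have hcoarea := hiso.sum_div_le hφ_pos hφ_mono hm S hb hSm (fun v => f v ^ 2)
    (fun v => sq_nonneg _) (fun v hv => by simp [hf v hv]) T hST
  set C := ∑ e ∈ G.edgesOf T, G.wt e * |f (G.src e) ^ 2 - f (G.tgt e) ^ 2| with hC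
  have hTN : ∑ v ∈ T, f v ^ 2 * G.vol v = N :=
    (Finset.sum_subset hST fun v _ hv => by simp [hf v hv]).symm
  -- Cauchy-Schwarz for `a |f² - g²| = √(aℓ) |f + g| · √(a/ℓ) |f - g|`, with `f`, `g` the values at
  -- the two ends.
  have hCS : C ^ 2 ≤ (4 * G.rhoSup * N) * G.energy T f := by
    have h1 := Finset.sum_mul_sq_le_sq_mul_sq (G.edgesOf T)
      (fun e => √(if G.src e = G.tgt e then 0 else G.edgeMeasure e) *
        |f (G.src e) + f (G.tgt e)|)
      (fun e => √(G.wt e / G.len e) * |f (G.src e) - f (G.tgt e)|)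
    have hA : ∀ e, (√(if G.src e = G.tgt e then 0 else G.edgeMeasure e) *
        |f (G.src e) + f (G.tgt e)|) ^ 2 = if G.src e = G.tgt e then 0 else
          G.edgeMeasure e * (f (G.src e) + f (G.tgt e)) ^ 2 := by
      intro e
      rw [mul_pow, sq_abs]
      split_ifs
      · simp
      · rw [Real.sq_sqrt (G.edgeMeasure_pos e).le]
    have hB : ∀ e, (√(G.wt e / G.len e) * |f (G.src e) - f (G.tgt e)|) ^ 2 =
        G.wt e / G.len e * (f (G.src e) - f (G.tgt e)) ^ 2 := by
      intro e
      rw [mul_pow, sq_abs, Real.sq_sqrt (div_pos (G.wt_pos e) (G.len_pos e)).le]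
    have hAB : ∀ e, (√(if G.src e = G.tgt e then 0 else G.edgeMeasure e) *
        |f (G.src e) + f (G.tgt e)|) * (√(G.wt e / G.len e) * |f (G.src e) - f (G.tgt e)|) =
        G.wt e * |f (G.src e) ^ 2 - f (G.tgt e) ^ 2| := by
      intro e
      by_cases he : G.src e = G.tgt e
      · simp [he]
      · rw [if_neg he, mul_mul_mul_comm, ← Real.sqrt_mul
          (G.edgeMeasure_pos e).le, ← abs_mul]
        have h2 : G.edgeMeasure e * (G.wt e / G.len e) = G.wt e ^ 2 := by
          rw [edgeMeasure]
          field_simp [(G.len_pos e).ne']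
        rw [h2, Real.sqrt_sq (G.wt_pos e).le]
        congr 2
        ring
    simp only [hA, hB, hAB] at h1
    refine h1.trans (mul_le_mul_of_nonneg_right ?_ (G.energy_nonneg T f))
    rw [← hTN]
    exact sum_edgeMeasure_mul_le hρ fun v hv => hf v fun h => hv (hST h)
  have hNC : N ^ 2 ≤ φ m ^ 2 * ((4 * G.rhoSup * N) * G.energy T f) := by
    have h3 : N ≤ φ m * C := by
      rw [div_le_iff₀ hφ] at hcoarea
      linarith
    calc N ^ 2 ≤ (φ m * C) ^ 2 := by gcongr
      _ = φ m ^ 2 * C ^ 2 := by ring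
      _ ≤ _ := by gcongr
  have hρ0 : 0 ≤ G.rhoSup := Real.iSup_nonneg G.halfDegree_nonneg
  have hR : 0 ≤ 4 * G.rhoSup * φ m ^ 2 * G.energy T f :=
    mul_nonneg (by positivity) (G.energy_nonneg T f)
  -- `N² ≤ const · N · energy`, so one factor `N` is cancelled when it is nonzero.
  rcases hN0.eq_or_lt with h0 | h0
  · rw [← h0]
    exact hR
  · refine le_of_mul_le_mul_left ?_ h0
    linarith

/-- The Nash inequality. -/
lemma Isoperimetric.nash (hiso : G.Isoperimetric φ) (hφ_pos : ∀ x > 0, 0 < φ x)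
    (hφ_mono : MonotoneOn φ (Ioi 0)) (hρ : BddAbove (range G.halfDegree))
    {T : Finset V} (hb : ∀ v ∈ T, v ∉ G.bdry) {f : V → ℝ} (hf0 : ∀ v, 0 ≤ f v)
    (hf : ∀ v ∉ T, f v = 0) (hf1 : ∑ v ∈ T, f v * G.vol v ≤ 1)
    (hf2 : 0 < ∑ v ∈ T, f v ^ 2 * G.vol v) :
    ∑ v ∈ T, f v ^ 2 * G.vol v ≤
      8 * G.rhoSup * φ (4 / ∑ v ∈ T, f v ^ 2 * G.vol v) ^ 2 * G.energy T f := by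
  classical
  set N := ∑ v ∈ T, f v ^ 2 * G.vol v with hN
  -- At this level the loss `2s‖f‖₁` is at most `N / 2`, and by Markov's inequality `{f > s}` has
  -- volume at most `1/s = 4/N`, the argument of `φ`.
  set s := N / 4 with hs
  have hs0 : 0 < s := by positivity
  set h : V → ℝ := fun v => max (f v - s) 0 with hh
  set S := T.filter fun v => s < f v with hS
  have hvol : ∑ v ∈ S, G.vol v ≤ 4 / N := by
    have h1 : ∑ v ∈ S, s * G.vol v ≤ 1 := by
      refine le_trans ?_ hf1
      refine (Finset.sum_le_sum fun v hv => ?_).trans (Finset.sum_le_sum_of_subset_of_nonneg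
        (T.filter_subset _) fun v _ _ => mul_nonneg (hf0 v) (G.vol_pos v).le)
      exact mul_le_mul_of_nonneg_right (Finset.mem_filter.1 hv).2.le (G.vol_pos v).le
    rw [← Finset.mul_sum, hs] at h1
    rw [le_div_iff₀ hf2]
    linarith
  have hhS : ∀ v ∉ S, h v = 0 := by
    intro v hv
    refine max_eq_right (sub_nonpos.2 ?_)
    by_cases hvT : v ∈ T
    · exact not_lt.1 fun hlt => hv (Finset.mem_filter.2 ⟨hvT, hlt⟩)
    · rw [hf v hvT]
      exact hs0.le
  have hfk := hiso.sum_sq_le hφ_pos hφ_mono hρ (m := 4 / N) (by positivity) (S := S) (T := T)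
    (fun v hv => hb v (Finset.mem_filter.1 hv).1) hvol (T.filter_subset _) hhS
  -- Truncation is 1-Lipschitz. Both energies are taken over the edges of `T`, which is why
  -- `sum_sq_le` allows a set larger than the support.
  have hen : G.energy T h ≤ G.energy T f := by
    refine Finset.sum_le_sum fun e _ => mul_le_mul_of_nonneg_left ?_
      (div_pos (G.wt_pos e) (G.len_pos e)).le
    rw [sq_le_sq]
    refine (abs_max_sub_max_le_abs _ _ _).trans (le_of_eq ?_)
    rw [sub_sub_sub_cancel_right]
  -- Pointwise, `f² ≤ (f - s)₊² + 2sf`.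
  have hsum : N ≤ ∑ v ∈ S, h v ^ 2 * G.vol v + N / 2 := by
    have h1 : ∑ v ∈ S, h v ^ 2 * G.vol v = ∑ v ∈ T, h v ^ 2 * G.vol v :=
      Finset.sum_subset (T.filter_subset _) fun v _ hv => by simp [hhS v hv]
    have h2 : N ≤ ∑ v ∈ T, (h v ^ 2 * G.vol v + 2 * s * (f v * G.vol v)) := by
      refine Finset.sum_le_sum fun v _ => ?_
      have h3 : f v ^ 2 ≤ h v ^ 2 + 2 * s * f v := by
        simp only [hh]
        have := hf0 v
        rcases le_total (f v) s with h4 | h4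
        · rw [max_eq_right (sub_nonpos.2 h4)]
          nlinarith
        · rw [max_eq_left (sub_nonneg.2 h4)]
          nlinarith
      have := mul_le_mul_of_nonneg_right h3 (G.vol_pos v).le
      linarith
    rw [Finset.sum_add_distrib, ← Finset.mul_sum, ← h1] at h2
    have h5 : 2 * s * ∑ v ∈ T, f v * G.vol v ≤ 2 * s * 1 :=
      mul_le_mul_of_nonneg_left hf1 (by positivity)
    have h6 : 2 * s * 1 = N / 2 := by rw [hs]; ring
    linarith
  have hρ0 : 0 ≤ G.rhoSup := Real.iSup_nonneg G.halfDegree_nonneg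
  have := mul_le_mul_of_nonneg_left hen (by positivity : 0 ≤ 4 * G.rhoSup * φ (4 / N) ^ 2)
  linarith

end

noncomputable section

variable {V E : Type*} (G : MetricGraph V E)

/-! ### Elementary properties of the Laplacian -/

lemma laplacian_congr {f g : V → ℝ} (h : ∀ v, f v = g v) (x : V) :
    G.laplacian f x = G.laplacian g x := by
  rw [funext h]

lemma laplacian_sub (f g : V → ℝ) (x : V) :
    G.laplacian (fun v => f v - g v) x = G.laplacian f x - G.laplacian g x := by
  simp only [laplacian]
  rw [← sub_div, ← Finset.sum_sub_distrib]
  congr 1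
  exact Finset.sum_congr rfl fun e _ => by ring

lemma laplacian_add (f g : V → ℝ) (x : V) :
    G.laplacian (fun v => f v + g v) x = G.laplacian f x + G.laplacian g x := by
  simp only [laplacian]
  rw [← add_div, ← Finset.sum_add_distrib]
  congr 1
  exact Finset.sum_congr rfl fun e _ => by ring

lemma laplacian_const_mul (c : ℝ) (f : V → ℝ) (x : V) :
    G.laplacian (fun v => c * f v) x = c * G.laplacian f x := by
  simp only [laplacian]
  rw [← mul_div_assoc, Finset.mul_sum]
  congr 1
  exact Finset.sum_congr rfl fun e _ => by ring

lemma laplacian_const (c : ℝ) (x : V) : G.laplacian (fun _ => c) x = 0 := by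
  simp [laplacian]

lemma laplacian_sum {ι : Type*} (s : Finset ι) (f : ι → V → ℝ) (x : V) :
    G.laplacian (fun v => ∑ i ∈ s, f i v) x = ∑ i ∈ s, G.laplacian (f i) x := by
  classical
  induction s using Finset.induction_on with
  | empty => simpa using G.laplacian_const 0 x
  | insert i s hi ih =>
    simp only [Finset.sum_insert hi]
    rw [laplacian_add, ih]

/-- The Laplacian at `x` only involves finitely many terms. -/
lemma exists_laplacian_eq (x : V) : ∃ (s : Finset V) (c : V → ℝ), ∀ f : V → ℝ,
    G.laplacian f x = ∑ v ∈ s, c v * f v := by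
  classical
  let o : E → V := fun e => if G.src e = x then G.tgt e else G.src e
  refine ⟨insert x ((G.incident x).image o), fun v => ∑ e ∈ G.incident x,
    G.wt e / G.len e / G.vol x * ((if x = v then 1 else 0) - if o e = v then 1 else 0), ?_⟩
  intro f
  simp only [Finset.sum_mul]
  rw [Finset.sum_comm, laplacian, Finset.sum_div]
  refine Finset.sum_congr rfl fun e he => ?_
  simp only [mul_assoc, ← Finset.mul_sum, sub_mul, Finset.sum_sub_distrib, ite_mul, one_mul,
    zero_mul, Finset.sum_ite_eq, Finset.mem_insert_self, if_true]
  rw [if_pos (Finset.mem_insert_of_mem (Finset.mem_image_of_mem o he))]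
  simp only [o]
  ring

lemma tendsto_laplacian {ι : Type*} {l : Filter ι} {u : ι → V → ℝ} {f : V → ℝ}
    (hu : ∀ v, Tendsto (fun i => u i v) l (𝓝 (f v))) (x : V) :
    Tendsto (fun i => G.laplacian (u i) x) l (𝓝 (G.laplacian f x)) := by
  obtain ⟨F, c, h⟩ := G.exists_laplacian_eq x
  simp only [h]
  exact tendsto_finsetSum _ fun v _ => (hu v).const_mul _

lemma hasSum_laplacian {ι : Type*} {u : ι → V → ℝ} {f : V → ℝ}
    (hu : ∀ v, HasSum (fun i => u i v) (f v)) (x : V) :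
    HasSum (fun i => G.laplacian (u i) x) (G.laplacian f x) := by
  obtain ⟨F, c, h⟩ := G.exists_laplacian_eq x
  simp only [h]
  exact hasSum_sum fun v _ => (hu v).mul_left _

/-- A bound for the Laplacian, with a constant that depends on `x` only. -/
lemma exists_abs_laplacian_le (b : V → ℝ) (x : V) : ∃ C : ℝ, 0 ≤ C ∧ ∀ (f : V → ℝ) (r : ℝ), 0 ≤ r →
    (∀ v, |f v| ≤ b v * r) → |G.laplacian f x| ≤ C * r := by
  obtain ⟨F, c, h⟩ := G.exists_laplacian_eq x
  refine ⟨∑ v ∈ F, |c v| * |b v|, Finset.sum_nonneg fun v _ => by positivity, ?_⟩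
  intro f r hr hf
  rw [h, Finset.sum_mul]
  refine (Finset.abs_sum_le_sum_abs _ _).trans (Finset.sum_le_sum fun v _ => ?_)
  rw [abs_mul, mul_assoc]
  refine mul_le_mul_of_nonneg_left ((hf v).trans ?_) (abs_nonneg _)
  exact mul_le_mul_of_nonneg_right (le_abs_self _) hr

/-! ### The heat equation on a finite set of vertices -/

/-- `u` solves the heat equation on the finite set `D`, for all times. -/
structure IsHeatFlow (D : Finset V) (u : V → ℝ → ℝ) : Prop where
  hasDerivAt : ∀ x ∈ D, ∀ t, HasDerivAt (u x) (-G.laplacian (fun v => u v t) x) t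
  eq_zero : ∀ x ∉ D, ∀ t, u x t = 0

open Classical in
/-- The extension of a function on `D` by zero. -/
def extendZero (D : Finset V) : (D → ℝ) →ₗ[ℝ] (V → ℝ) where
  toFun f v := if h : v ∈ D then f ⟨v, h⟩ else 0
  map_add' f g := by
    ext v
    by_cases h : v ∈ D <;> simp [h]
  map_smul' c f := by
    ext v
    by_cases h : v ∈ D <;> simp [h]

/-- The Laplacian with Dirichlet boundary conditions outside of `D`, up to sign. -/
def dirichletGenerator (D : Finset V) : (D → ℝ) →L[ℝ] (D → ℝ) :=
  LinearMap.toContinuousLinearMap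
    { toFun := fun f x => -G.laplacian (extendZero D f) x
      map_add' := fun f g => by
        ext x
        simp only [map_add, Pi.add_apply]
        rw [← neg_add, ← laplacian_add]
        rfl
      map_smul' := fun c f => by
        ext x
        simp only [map_smul, Pi.smul_apply, RingHom.id_apply, smul_eq_mul, mul_neg]
        rw [← laplacian_const_mul]
        rfl }

/-- A linear ODE on the finite-dimensional space `D → ℝ`, solved by the exponential of its
generator. The flow exists for negative times too, so two-sided derivatives are available at 0. -/
lemma exists_isHeatFlow (D : Finset V) (f : V → ℝ) :
    ∃ u : V → ℝ → ℝ, G.IsHeatFlow D u ∧ ∀ x ∈ D, u x 0 = f x := by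
  let A := G.dirichletGenerator D
  let w : ℝ → (D → ℝ) := fun t => NormedSpace.exp (t • A) fun x => f x
  have hw : ∀ t, HasDerivAt w (A (w t)) t := by
    intro t
    have h := (hasDerivAt_exp_smul_const' (𝕂 := ℝ) A t).clm_apply
      (hasDerivAt_const t (fun x : D => f x))
    simpa using h
  refine ⟨fun v t => extendZero D (w t) v, ⟨fun x hx t => ?_, fun x hx t => ?_⟩, fun x hx => ?_⟩
  · have h := hasDerivAt_pi.1 (hw t) ⟨x, hx⟩
    have h2 : (fun s => extendZero D (w s) x) = fun s => w s ⟨x, hx⟩ := by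
      ext s
      simp [extendZero, hx]
    rw [h2]
    exact h
  · simp [extendZero, hx]
  · simp [extendZero, hx, w]

/-- The heat kernel of the finite set `D`, with Dirichlet boundary conditions. -/
def finKernel (D : Finset V) (y : V) : V → ℝ → ℝ := (G.exists_isHeatFlow D (G.delta y)).choose

lemma isHeatFlow_finKernel (D : Finset V) (y : V) : G.IsHeatFlow D (G.finKernel D y) :=
  (G.exists_isHeatFlow D (G.delta y)).choose_spec.1

lemma finKernel_zero (D : Finset V) (y : V) {x : V} (hx : x ∈ D) :
    G.finKernel D y x 0 = G.delta y x :=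
  (G.exists_isHeatFlow D (G.delta y)).choose_spec.2 x hx

variable {G}

lemma IsHeatFlow.continuous {D : Finset V} {u : V → ℝ → ℝ} (hu : G.IsHeatFlow D u) (x : V) :
    Continuous (u x) := by
  by_cases hx : x ∈ D
  · exact continuous_iff_continuousAt.2 fun t => (hu.hasDerivAt x hx t).continuousAt
  · rw [show u x = fun _ => 0 from funext (hu.eq_zero x hx)]
    exact continuous_const

lemma laplacian_nonpos_of_min {f : V → ℝ} {x : V} (h : ∀ v, f x ≤ f v) : G.laplacian f x ≤ 0 := by
  refine div_nonpos_of_nonpos_of_nonneg (Finset.sum_nonpos fun e _ => ?_) (G.vol_pos x).le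
  exact mul_nonpos_of_nonneg_of_nonpos (div_pos (G.wt_pos e) (G.len_pos e)).le
    (sub_nonpos.2 (h _))

/-- The minimum principle for the heat equation. -/
theorem heat_nonneg {D : Finset V} {u : V → ℝ → ℝ} (hc : ∀ x ∈ D, ContinuousOn (u x) (Ici 0))
    (hd : ∀ x ∈ D, ∀ t > 0, HasDerivAt (u x) (-G.laplacian (fun v => u v t) x) t)
    (h0 : ∀ x ∈ D, 0 ≤ u x 0) (hout : ∀ x ∉ D, ∀ t ≥ 0, 0 ≤ u x t) (x : V) {t : ℝ} (ht : 0 ≤ t) :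
    0 ≤ u x t := by
  by_contra hlt
  rw [not_le] at hlt
  have hxD : x ∈ D := by
    by_contra hx
    exact (hout x hx t ht).not_gt hlt
  -- The term `ε(1 + t)` makes the argument strict: at a negative space-time minimum of `w`, the
  -- heat equation gives a time derivative of at least `ε`, yet it cannot be positive there.
  obtain ⟨ε, hε, hεx⟩ : ∃ ε > 0, u x t + ε * (1 + t) < 0 := by
    refine ⟨-u x t / (2 * (1 + t)), div_pos (neg_pos.2 hlt) (by positivity), ?_⟩
    have : -u x t / (2 * (1 + t)) * (1 + t) = -u x t / 2 := by field_simp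
    rw [this]
    linarith
  set w : V → ℝ → ℝ := fun v s => u v s + ε * (1 + s) with hw
  have hmin : ∀ v ∈ D, ∃ s ∈ Icc 0 t, ∀ r ∈ Icc 0 t, w v s ≤ w v r := by
    intro v hv
    have hcw : ContinuousOn (w v) (Icc 0 t) :=
      ((hc v hv).mono Icc_subset_Ici_self).add (by fun_prop)
    obtain ⟨s, hs, hs'⟩ := isCompact_Icc.exists_isMinOn ⟨0, left_mem_Icc.2 ht⟩ hcw
    exact ⟨s, hs, fun r hr => hs' hr⟩
  choose! T hT hTmin using hmin
  obtain ⟨y, hy, hymin⟩ := D.exists_min_image (fun v => w v (T v)) ⟨x, hxD⟩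
  set s := T y with hs
  have hall : ∀ v ∈ D, ∀ r ∈ Icc 0 t, w y s ≤ w v r := fun v hv r hr =>
    (hymin v hv).trans (hTmin v hv r hr)
  have hneg : w y s < 0 := (hall x hxD t (right_mem_Icc.2 ht)).trans_lt hεx
  have hs0 : 0 < s := by
    refine lt_of_le_of_ne (hT y hy).1 fun h => ?_
    have h1 := h0 y hy
    rw [← h] at hneg
    simp only [hw] at hneg
    linarith
  have hlap : G.laplacian (fun v => u v s) y ≤ 0 := by
    refine laplacian_nonpos_of_min fun v => ?_
    by_cases hv : v ∈ D
    · have := hall v hv s (hT y hy)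
      simp only [hw] at this
      linarith
    -- Outside `D` the minimum is not compared through `w`: `u y s` is negative there, and `u v s`
    -- is not.
    · have h1 := hout v hv s hs0.le
      simp only [hw] at hneg
      have : 0 < ε * (1 + s) := by positivity
      linarith
  have hder : HasDerivAt (w y) (-G.laplacian (fun v => u v s) y + ε * 1) s :=
    (hd y hy s hs0).add (((hasDerivAt_id s).const_add 1).const_mul ε)
  -- The minimum may be at the right end of `[0, t]`, so only slopes from the left are used.
  have hle : -G.laplacian (fun v => u v s) y + ε * 1 ≤ 0 := by
    have h1 := (hasDerivAt_iff_tendsto_slope.1 hder).mono_left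
      (nhdsWithin_mono s fun r (hr : r ∈ Iio s) => ne_of_lt hr)
    refine le_of_tendsto h1 ?_
    filter_upwards [Ioo_mem_nhdsLT hs0] with r hr
    rw [slope_def_field]
    refine div_nonpos_of_nonneg_of_nonpos (sub_nonneg.2 ?_) (sub_nonpos.2 hr.2.le)
    exact hall y hy r ⟨hr.1.le, hr.2.le.trans (hT y hy).2⟩
  linarith

/-- The derivative in `s` of the pairing of `u(s)` with `w(t - s)` vanishes because the Laplacian is
symmetric. Both the semigroup law and the symmetry of `finKernel` follow. -/
lemma IsHeatFlow.pairing_eq {D : Finset V} {u w : V → ℝ → ℝ} (hu : G.IsHeatFlow D u)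
    (hw : G.IsHeatFlow D w) (t s s' : ℝ) :
    ∑ v ∈ D, u v s * w v (t - s) * G.vol v = ∑ v ∈ D, u v s' * w v (t - s') * G.vol v := by
  have hder : ∀ r, HasDerivAt (fun r => ∑ v ∈ D, u v r * w v (t - r) * G.vol v) 0 r := by
    intro r
    have h1 : HasDerivAt (fun r => ∑ v ∈ D, u v r * w v (t - r) * G.vol v)
        (∑ v ∈ D, (-G.laplacian (fun z => u z r) v * w v (t - r) +
          u v r * -(-G.laplacian (fun z => w z (t - r)) v)) * G.vol v) r := by
      refine HasDerivAt.fun_sum fun v hv => HasDerivAt.mul_const ?_ _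
      refine (hu.hasDerivAt v hv r).fun_mul ?_
      exact (hw.hasDerivAt v hv (t - r)).comp_const_sub t r
    convert h1 using 1
    have h2 := G.sum_mul_laplacian_comm (S := D) (f := fun z => u z r) (g := fun z => w z (t - r))
      (fun v hv => hu.eq_zero v hv r) (fun v hv => hw.eq_zero v hv (t - r))
    rw [← sub_eq_zero, ← Finset.sum_sub_distrib] at h2
    rw [← neg_zero, ← h2, ← Finset.sum_neg_distrib]
    exact Finset.sum_congr rfl fun v _ => by ring
  exact is_const_of_deriv_eq_zero (fun r => (hder r).differentiableAt) (fun r => (hder r).deriv)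
    s s'

variable (G)

lemma sum_delta_mul {D : Finset V} {y : V} {f : V → ℝ} (hf : ∀ v ∉ D, f v = 0) :
    ∑ v ∈ D, G.delta y v * f v * G.vol v = f y := by
  classical
  have : ∀ v ∈ D, G.delta y v * f v * G.vol v = if y = v then f v else 0 := by
    intro v _
    have := (G.vol_pos y).ne'
    by_cases h : v = y
    · subst h
      simp only [delta, if_true]
      field_simp
    · simp [delta, h, Ne.symm h]
  rw [Finset.sum_congr rfl this, Finset.sum_ite_eq]
  split_ifs with h
  · rfl
  · exact (hf y h).symm

lemma sum_finKernel_mul (D : Finset V) (x y : V) (τ t : ℝ) :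
    ∑ v ∈ D, G.finKernel D x v τ * G.finKernel D y v (t - τ) * G.vol v = G.finKernel D y x t := by
  rw [(G.isHeatFlow_finKernel D x).pairing_eq (G.isHeatFlow_finKernel D y) t τ 0, sub_zero,
    ← G.sum_delta_mul (D := D) (y := x) (f := fun v => G.finKernel D y v t)
      fun v hv => (G.isHeatFlow_finKernel D y).eq_zero v hv t]
  exact Finset.sum_congr rfl fun v hv => by rw [G.finKernel_zero D x hv]

lemma finKernel_comm (D : Finset V) (x y : V) (t : ℝ) :
    G.finKernel D y x t = G.finKernel D x y t := by
  rw [← G.sum_finKernel_mul D x y t t, ← G.sum_finKernel_mul D y x 0 t]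
  refine Finset.sum_congr rfl fun v _ => ?_
  rw [sub_self, sub_zero]
  ring

lemma delta_nonneg (y x : V) : 0 ≤ G.delta y x := by
  have := G.vol_pos y
  simp only [delta]
  split_ifs <;> positivity

lemma finKernel_nonneg (D : Finset V) (y x : V) {t : ℝ} (ht : 0 ≤ t) : 0 ≤ G.finKernel D y x t :=
  have h := G.isHeatFlow_finKernel D y
  heat_nonneg (fun v _ => (h.continuous v).continuousOn) (fun v hv t _ => h.hasDerivAt v hv t)
    (fun v hv => (G.delta_nonneg y v).trans_eq (G.finKernel_zero D y hv).symm)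
    (fun v hv t _ => (h.eq_zero v hv t).ge) x ht

lemma finKernel_eq_zero {D : Finset V} {y : V} (hy : y ∉ D) (x : V) (t : ℝ) :
    G.finKernel D y x t = 0 := by
  rw [← finKernel_comm]
  exact (G.isHeatFlow_finKernel D x).eq_zero y hy t

/-- A nonnegative solution with the right initial values dominates the kernel of a finite set. -/
lemma finKernel_le {D : Finset V} {y : V} {u : V → ℝ → ℝ}
    (hc : ∀ x ∈ D, ContinuousOn (u x) (Ici 0))
    (hd : ∀ x ∈ D, ∀ t > 0, HasDerivAt (u x) (-G.laplacian (fun v => u v t) x) t)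
    (h0 : ∀ x ∈ D, u x 0 = G.delta y x) (hu : ∀ x, ∀ t ≥ 0, 0 ≤ u x t) (x : V) {t : ℝ}
    (ht : 0 ≤ t) : G.finKernel D y x t ≤ u x t := by
  have h := G.isHeatFlow_finKernel D y
  refine sub_nonneg.1 (heat_nonneg (G := G) (D := D)
    (u := fun v s => u v s - G.finKernel D y v s) ?_ ?_ ?_ ?_ x ht)
  · exact fun v hv => (hc v hv).sub (h.continuous v).continuousOn
  · intro v hv s hs
    rw [laplacian_sub, neg_sub']
    exact (hd v hv s hs).sub (h.hasDerivAt v hv s)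
  · intro v hv
    rw [h0 v hv, G.finKernel_zero D y hv, sub_self]
  · intro v hv s hs
    rw [h.eq_zero v hv s, sub_zero]
    exact hu v s hs

lemma finKernel_mono {D D' : Finset V} (hD : D ⊆ D') (y x : V) {t : ℝ} (ht : 0 ≤ t) :
    G.finKernel D y x t ≤ G.finKernel D' y x t :=
  have h := G.isHeatFlow_finKernel D' y
  G.finKernel_le (fun v _ => (h.continuous v).continuousOn)
    (fun v hv s _ => h.hasDerivAt v (hD hv) s) (fun _ hv => G.finKernel_zero D' y (hD hv))
    (fun v _ hs => G.finKernel_nonneg D' y v hs) x ht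

/-- One minus the total mass solves the heat equation on `D`, is 0 there initially and 1 outside, so
the minimum principle applies. Symmetry first makes `x` the space variable. -/
lemma sum_finKernel_le_one (D : Finset V) (x : V) {t : ℝ} (ht : 0 ≤ t) :
    ∑ y ∈ D, G.finKernel D x y t * G.vol y ≤ 1 := by
  have h := G.isHeatFlow_finKernel D
  simp only [G.finKernel_comm D _ x]
  classical
  refine sub_nonneg.1 (heat_nonneg (G := G) (D := D)
    (u := fun v s => 1 - ∑ y ∈ D, G.finKernel D y v s * G.vol y) ?_ ?_ ?_ ?_ x ht)
  · exact fun v _ => (continuous_const.sub (continuous_finsetSum _ fun y _ =>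
      ((h y).continuous v).mul continuous_const)).continuousOn
  · intro v hv s _
    rw [laplacian_sub, laplacian_const, laplacian_sum, neg_sub, sub_zero]
    have h1 : HasDerivAt (fun s => 1 - ∑ y ∈ D, G.finKernel D y v s * G.vol y)
        (-∑ y ∈ D, -G.laplacian (fun z => G.finKernel D y z s) v * G.vol y) s :=
      (HasDerivAt.fun_sum fun y _ => ((h y).hasDerivAt v hv s).mul_const _).const_sub 1
    convert h1 using 1
    rw [← Finset.sum_neg_distrib]
    refine Finset.sum_congr rfl fun y _ => ?_
    rw [neg_mul, neg_neg, mul_comm, ← laplacian_const_mul]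
    exact G.laplacian_congr (fun z => mul_comm _ _) v
  · intro v hv
    have h1 : ∀ y ∈ D, G.finKernel D y v 0 * G.vol y = if v = y then 1 else 0 := by
      intro y _
      rw [G.finKernel_zero D y hv, delta]
      split_ifs
      · exact one_div_mul_cancel (G.vol_pos y).ne'
      · exact zero_mul _
    rw [Finset.sum_congr rfl h1, Finset.sum_ite_eq, if_pos hv, sub_self]
  · intro v hv s _
    rw [Finset.sum_eq_zero fun y _ => by rw [(h y).eq_zero v hv s, zero_mul], sub_zero]
    exact zero_le_one

end

noncomputable section

variable {V E : Type*} (G : MetricGraph V E)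

/-! ### Bounds that are uniform in the finite set -/

lemma finKernel_le_inv (D : Finset V) (y x : V) {t : ℝ} (ht : 0 ≤ t) :
    G.finKernel D y x t ≤ 1 / G.vol y := by
  have hy := G.vol_pos y
  by_cases h : y ∈ D
  · rw [le_div_iff₀ hy, finKernel_comm]
    exact (Finset.single_le_sum (f := fun y => G.finKernel D x y t * G.vol y) (fun z _ =>
      mul_nonneg (G.finKernel_nonneg D x z ht) (G.vol_pos z).le) h).trans
      (G.sum_finKernel_le_one D x ht)
  · rw [G.finKernel_eq_zero h]
    positivity

/-- The bound `1 / G.vol y` and local finiteness bound the time derivative independently of `D`. -/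
lemma exists_finKernel_lipschitz (y x : V) : ∃ C : ℝ, 0 ≤ C ∧ ∀ (D : Finset V) (s t : ℝ),
    0 ≤ s → 0 ≤ t → |G.finKernel D y x t - G.finKernel D y x s| ≤ C * |t - s| := by
  obtain ⟨C, hC, h⟩ := G.exists_abs_laplacian_le (fun _ => 1 / G.vol y) x
  refine ⟨C, hC, fun D s t hs ht => ?_⟩
  have hu := G.isHeatFlow_finKernel D y
  by_cases hx : x ∈ D
  · refine Convex.norm_image_sub_le_of_norm_hasDerivWithin_le (s := Ici (0 : ℝ))
      (fun r _ => (hu.hasDerivAt x hx r).hasDerivWithinAt) (fun r hr => ?_) (convex_Ici 0) hs ht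
    have h1 := h (fun v => G.finKernel D y v r) 1 zero_le_one fun v => by
      rw [abs_of_nonneg (G.finKernel_nonneg D y v hr), mul_one]
      exact G.finKernel_le_inv D y v hr
    rw [norm_neg, Real.norm_eq_abs]
    linarith
  · rw [hu.eq_zero x hx, hu.eq_zero x hx, sub_self, abs_zero]
    positivity

/-- The Lipschitz bounds at `x` and its neighbours make the time derivative Lipschitz. A quadratic
remainder uniform in `D` survives pointwise limits, so no convergence of derivatives is needed. -/
lemma exists_finKernel_taylor (y x : V) : ∃ C : ℝ, ∀ (D : Finset V), x ∈ D → ∀ s t : ℝ,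
    0 ≤ s → 0 ≤ t → |G.finKernel D y x t - G.finKernel D y x s -
      (t - s) * -G.laplacian (fun v => G.finKernel D y v s) x| ≤ C * (t - s) ^ 2 := by
  choose L hL0 hL using G.exists_finKernel_lipschitz y
  obtain ⟨C, hC, h⟩ := G.exists_abs_laplacian_le L x
  refine ⟨C, fun D hx s t hs ht => ?_⟩
  have hu := G.isHeatFlow_finKernel D y
  set b := G.laplacian (fun v => G.finKernel D y v s) x with hb
  have h1 := Convex.norm_image_sub_le_of_norm_hasDerivWithin_le (s := uIcc s t)
    (f := fun r => G.finKernel D y x r + r * b)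
    (f' := fun r => -G.laplacian (fun v => G.finKernel D y v r) x + 1 * b)
    (C := C * |t - s|) (x := s) (y := t)
    (fun r _ => ((hu.hasDerivAt x hx r).add
      ((hasDerivAt_id r).mul_const b)).hasDerivWithinAt) (fun r hr => ?_)
    (convex_uIcc s t) left_mem_uIcc right_mem_uIcc
  · rw [Real.norm_eq_abs, Real.norm_eq_abs, mul_assoc, ← sq, sq_abs] at h1
    refine le_trans (le_of_eq ?_) h1
    congr 1
    ring
  · have hr0 : 0 ≤ r := (le_min hs ht).trans hr.1
    have h2 := h (fun v => G.finKernel D y v s - G.finKernel D y v r) |s - r| (abs_nonneg _)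
      fun v => hL v D r s hr0 hs
    rw [laplacian_sub] at h2
    rw [one_mul, neg_add_eq_sub, Real.norm_eq_abs]
    refine h2.trans (mul_le_mul_of_nonneg_left ?_ hC)
    rw [abs_sub_comm]
    exact abs_sub_left_of_mem_uIcc hr

/-! ### The minimal heat kernel -/

open Classical in
/-- The vertices of a finite set that are not on the boundary. -/
def interiorPart (S : Finset V) : Finset V := S.filter (· ∉ G.bdry)

lemma mem_interiorPart {S : Finset V} {v : V} : v ∈ G.interiorPart S ↔ v ∈ S ∧ v ∉ G.bdry := by
  simp [interiorPart]

/-- The minimal heat kernel, as the supremum of the heat kernels of the finite sets. -/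
def heatKernel (x y : V) (t : ℝ) : ℝ := ⨆ S : Finset V, G.finKernel (G.interiorPart S) y x t

lemma bddAbove_finKernel (x y : V) {t : ℝ} (ht : 0 ≤ t) :
    BddAbove (range fun S : Finset V => G.finKernel (G.interiorPart S) y x t) :=
  ⟨1 / G.vol y, forall_mem_range.2 fun _ => G.finKernel_le_inv _ y x ht⟩

lemma finKernel_le_heatKernel (S : Finset V) (x y : V) {t : ℝ} (ht : 0 ≤ t) :
    G.finKernel (G.interiorPart S) y x t ≤ G.heatKernel x y t :=
  le_ciSup (G.bddAbove_finKernel x y ht) S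

lemma tendsto_finKernel (x y : V) {t : ℝ} (ht : 0 ≤ t) :
    Tendsto (fun S : Finset V => G.finKernel (G.interiorPart S) y x t) atTop
      (𝓝 (G.heatKernel x y t)) := by
  classical
  exact tendsto_atTop_ciSup (fun S S' h => G.finKernel_mono
    (Finset.filter_subset_filter _ h) y x ht) (G.bddAbove_finKernel x y ht)

lemma heatKernel_comm (x y : V) (t : ℝ) : G.heatKernel x y t = G.heatKernel y x t := by
  simp only [heatKernel, G.finKernel_comm _ x y]

lemma heatKernel_nonneg (x y : V) {t : ℝ} (ht : 0 ≤ t) : 0 ≤ G.heatKernel x y t :=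
  Real.iSup_nonneg fun _ => G.finKernel_nonneg _ y x ht

lemma heatKernel_of_mem_bdry {y : V} (hy : y ∈ G.bdry) (x : V) (t : ℝ) :
    G.heatKernel x y t = 0 := by
  have h : ∀ S : Finset V, G.finKernel (G.interiorPart S) y x t = 0 := fun S =>
    G.finKernel_eq_zero (fun h => (G.mem_interiorPart.1 h).2 hy) x t
  simp [heatKernel, h]

lemma eventually_mem_interiorPart {x : V} (hx : x ∉ G.bdry) :
    ∀ᶠ S : Finset V in atTop, x ∈ G.interiorPart S := by
  filter_upwards [eventually_ge_atTop {x}] with S hS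
  exact G.mem_interiorPart.2 ⟨hS (Finset.mem_singleton_self x), hx⟩

lemma continuousOn_heatKernel (x y : V) : ContinuousOn (G.heatKernel x y) (Ici 0) := by
  obtain ⟨C, hC, h⟩ := G.exists_finKernel_lipschitz y x
  refine (LipschitzOnWith.of_dist_le_mul (K := ⟨C, hC⟩) fun t ht s hs => ?_).continuousOn
  exact le_of_tendsto ((G.tendsto_finKernel x y ht).sub (G.tendsto_finKernel x y hs)).abs
    (Eventually.of_forall fun S => h _ s t hs ht)

/-- The uniform Taylor estimate passes to the limit, as the Laplacian at `x` has finitely many terms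
and `x` eventually lies in the finite set. -/
lemma hasDerivAt_heatKernel {x : V} (hx : x ∉ G.bdry) (y : V) {t : ℝ} (ht : 0 < t) :
    HasDerivAt (G.heatKernel x y) (-G.laplacian (fun z => G.heatKernel z y t) x) t := by
  obtain ⟨C, h⟩ := G.exists_finKernel_taylor y x
  refine HasDerivAt.of_isLittleO ((Asymptotics.IsBigO.of_bound C ?_).trans_isLittleO
    (Asymptotics.isLittleO_pow_sub_sub t one_lt_two))
  filter_upwards [lt_mem_nhds ht] with s hs
  have h1 := (((G.tendsto_finKernel x y hs.le).sub (G.tendsto_finKernel x y ht.le)).sub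
    ((G.tendsto_laplacian (fun v => G.tendsto_finKernel v y ht.le) x).neg.const_mul
      (s - t))).abs
  have h2 := le_of_tendsto h1 ((G.eventually_mem_interiorPart hx).mono fun S hS =>
    h _ hS t s ht.le hs.le)
  rw [norm_pow, norm_norm, Real.norm_eq_abs, Real.norm_eq_abs, sq_abs]
  exact h2

lemma heatKernel_zero {x : V} (hx : x ∉ G.bdry) (y : V) : G.heatKernel x y 0 = G.delta y x :=
  tendsto_nhds_unique (G.tendsto_finKernel x y le_rfl)
    (tendsto_const_nhds.congr' ((G.eventually_mem_interiorPart hx).mono fun _ hS =>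
      (G.finKernel_zero _ y hS).symm))

/-- Monotone convergence: partial sums are bounded by limits of the finite identities, while each
finite kernel is dominated termwise by the limit kernel. -/
lemma hasSum_heatKernel_mul (x y : V) {τ t : ℝ} (hτ : 0 ≤ τ) (hτt : τ ≤ t) :
    HasSum (fun s => G.heatKernel x s τ * G.heatKernel s y (t - τ) * G.vol s)
      (G.heatKernel x y t) := by
  have ht := hτ.trans hτt
  have htτ := sub_nonneg.2 hτt
  have hfin : ∀ D : Finset V, ∑ s ∈ D, G.finKernel D s x τ * G.finKernel D y s (t - τ) * G.vol s =
      G.finKernel D y x t := by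
    intro D
    rw [← G.sum_finKernel_mul D x y τ t]
    exact Finset.sum_congr rfl fun s _ => by rw [G.finKernel_comm D x s]
  have hterm : ∀ s, 0 ≤ G.heatKernel x s τ * G.heatKernel s y (t - τ) * G.vol s := fun s =>
    mul_nonneg (mul_nonneg (G.heatKernel_nonneg x s hτ) (G.heatKernel_nonneg s y htτ))
      (G.vol_pos s).le
  refine hasSum_of_isLUB_of_nonneg _ hterm ⟨forall_mem_range.2 fun F => ?_, fun b hb => ?_⟩
  · refine le_of_tendsto_of_tendsto (tendsto_finsetSum F fun s _ =>
      ((G.tendsto_finKernel x s hτ).mul (G.tendsto_finKernel s y htτ)).mul_const (G.vol s))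
      (G.tendsto_finKernel x y ht) (Eventually.of_forall fun S => ?_)
    classical
    set D := G.interiorPart S
    have hnn : ∀ s, 0 ≤ G.finKernel D s x τ * G.finKernel D y s (t - τ) * G.vol s := fun s =>
      mul_nonneg (mul_nonneg (G.finKernel_nonneg D s x hτ) (G.finKernel_nonneg D y s htτ))
        (G.vol_pos s).le
    simp only
    rw [← hfin D, ← Finset.sum_filter_add_sum_filter_not F (· ∈ D),
      Finset.sum_eq_zero (s := F.filter (· ∉ D)) fun s hs => by
        rw [G.finKernel_eq_zero (Finset.mem_filter.1 hs).2, zero_mul, zero_mul], add_zero]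
    exact Finset.sum_le_sum_of_subset_of_nonneg (fun s hs => (Finset.mem_filter.1 hs).2)
      fun s _ _ => hnn s
  · refine le_of_tendsto (G.tendsto_finKernel x y ht) (Eventually.of_forall fun S => ?_)
    rw [← hfin]
    refine (Finset.sum_le_sum fun s _ => ?_).trans (hb ⟨G.interiorPart S, rfl⟩)
    refine mul_le_mul_of_nonneg_right ?_ (G.vol_pos s).le
    exact mul_le_mul (G.finKernel_le_heatKernel S x s hτ) (G.finKernel_le_heatKernel S s y htτ)
      (G.finKernel_nonneg _ y s htτ) (G.heatKernel_nonneg x s hτ)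

/-- By symmetry the time derivative is also minus the Laplacian in `y`, a finite linear combination,
which commutes with the sum over `s`. -/
lemma hasSum_heatKernel_mul_deriv (x y : V) {τ t : ℝ} (hτ : 0 ≤ τ) (hτt : τ < t) :
    HasSum (fun s => G.heatKernel x s τ * deriv (G.heatKernel s y) (t - τ) * G.vol s)
      (deriv (G.heatKernel x y) t) := by
  have hr := sub_pos.2 hτt
  by_cases hy : y ∈ G.bdry
  · have h : ∀ s, G.heatKernel s y = fun _ => 0 := fun s =>
      funext fun t => G.heatKernel_of_mem_bdry hy s t
    simp only [h, deriv_const, mul_zero, zero_mul]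
    exact hasSum_zero
  · have hderiv : ∀ s, ∀ r > 0, deriv (G.heatKernel s y) r =
        -G.laplacian (fun z => G.heatKernel z s r) y := fun s r hr => by
      rw [show G.heatKernel s y = G.heatKernel y s from funext (G.heatKernel_comm s y)]
      exact (G.hasDerivAt_heatKernel hy s hr).deriv
    rw [hderiv x t (hτ.trans_lt hτt)]
    have h1 : ∀ z, HasSum (fun s => G.heatKernel x s τ * G.vol s * G.heatKernel z s (t - τ))
        (G.heatKernel z x t) := fun z => by
      have h2 := G.hasSum_heatKernel_mul x z hτ hτt.le
      simp only [G.heatKernel_comm _ z] at h2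
      simpa only [mul_right_comm] using h2
    have h2 : (fun s => G.heatKernel x s τ * deriv (G.heatKernel s y) (t - τ) * G.vol s) =
        fun s => -G.laplacian (fun z =>
          G.heatKernel x s τ * G.vol s * G.heatKernel z s (t - τ)) y := by
      ext s
      rw [hderiv s _ hr, laplacian_const_mul]
      ring
    rw [h2]
    exact (G.hasSum_laplacian h1 y).neg

theorem isMinimalHeatKernel_heatKernel : G.IsMinimalHeatKernel G.heatKernel where
  solution y _ :=
    { continuousOn := fun x => G.continuousOn_heatKernel x y
      heat := fun x hx t ht => G.hasDerivAt_heatKernel hx y ht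
      initial := fun x hx => G.heatKernel_zero hx y
      boundary := fun x hx t _ => by
        rw [G.heatKernel_comm, G.heatKernel_of_mem_bdry hx] }
  boundary y hy x t _ := G.heatKernel_of_mem_bdry hy x t
  symm x y t _ := G.heatKernel_comm x y t
  self_reproducing x y τ t hτ hτt := G.hasSum_heatKernel_mul x y hτ hτt
  deriv_self_reproducing x y τ t hτ hτt := G.hasSum_heatKernel_mul_deriv x y hτ hτt
  nonneg x y t ht := G.heatKernel_nonneg x y ht
  -- The finite sets avoid `G.bdry`, so `H` solves the heat equation on them and dominates each
  -- finite kernel.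
  minimal H hH hH0 x y t ht := by
    refine ciSup_le fun S => ?_
    by_cases hy : y ∈ G.bdry
    · rw [G.finKernel_eq_zero fun h => (G.mem_interiorPart.1 h).2 hy]
      exact hH0 x y t ht
    · have h := hH.solution y hy
      have hb : ∀ v ∈ G.interiorPart S, v ∉ G.bdry := fun v hv => (G.mem_interiorPart.1 hv).2
      exact G.finKernel_le (u := fun x t => H x y t) (fun v _ => h.continuousOn v)
        (fun v hv s hs => h.heat v (hb v hv) s hs) (fun v hv => h.initial v (hb v hv))
        (fun v s hs => hH0 v y s hs) x ht

end

end MetricGraph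

/-! ### The decay integral -/

section DecayIntegral

open MeasureTheory

variable {φ : ℝ → ℝ}

lemma antitoneOn_decayIntegrand (hφ_pos : ∀ x > 0, 0 < φ x) (hφ_mono : MonotoneOn φ (Ioi 0)) :
    AntitoneOn (fun u => φ (4 / u) ^ 2 / u) (Ioi 0) := by
  intro a ha b hb hab
  have ha' : (0 : ℝ) < a := ha
  have hb' : (0 : ℝ) < b := hb
  have h1 : φ (4 / b) ≤ φ (4 / a) := hφ_mono (by simpa using hb') (by simpa using ha')
    (div_le_div_of_nonneg_left (by norm_num) ha' hab)
  have h2 := hφ_pos (4 / b) (by positivity)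
  exact div_le_div₀ (sq_nonneg _) (by gcongr) ha' hab

/-- On `[a, b]` the integrand is smallest at `b`. This replaces `F' = -φ(4/u)²/u`, which may fail
where `φ` jumps. -/
lemma le_decayIntegral_sub (hφ_pos : ∀ x > 0, 0 < φ x) (hφ_mono : MonotoneOn φ (Ioi 0))
    (hF : ∀ x > 0, IntegrableOn (fun u => φ (4 / u) ^ 2 / u) (Ioi x)) {a b : ℝ} (ha : 0 < a)
    (hab : a ≤ b) :
    φ (4 / b) ^ 2 / b * (b - a) ≤ decayIntegral φ a - decayIntegral φ b := by
  rw [decayIntegral, decayIntegral, intervalIntegral.integral_Ioi_sub_Ioi (hF a ha) hab]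
  have h := intervalIntegral.integral_mono_on (μ := volume) hab
    (intervalIntegrable_const (c := φ (4 / b) ^ 2 / b))
    ((intervalIntegrable_iff_integrableOn_Ioc_of_le hab).2
      ((hF a ha).mono_set Ioc_subset_Ioi_self))
    fun u hu => antitoneOn_decayIntegrand hφ_pos hφ_mono (ha.trans_le hu.1) (ha.trans_le hab) hu.2
  rw [intervalIntegral.integral_const, smul_eq_mul] at h
  linarith

lemma strictAntiOn_decayIntegral (hφ_pos : ∀ x > 0, 0 < φ x) (hφ_mono : MonotoneOn φ (Ioi 0))
    (hF : ∀ x > 0, IntegrableOn (fun u => φ (4 / u) ^ 2 / u) (Ioi x)) :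
    StrictAntiOn (decayIntegral φ) (Ioi 0) := by
  intro a ha b hb hab
  have hb' : (0 : ℝ) < b := hb
  have h := le_decayIntegral_sub hφ_pos hφ_mono hF ha hab.le
  have h1 := hφ_pos (4 / b) (by positivity)
  have h2 : 0 < φ (4 / b) ^ 2 / b * (b - a) := mul_pos (by positivity) (sub_pos.2 hab)
  linarith

lemma decayIntegral_nonneg (φ : ℝ → ℝ) {x : ℝ} (hx : 0 ≤ x) : 0 ≤ decayIntegral φ x :=
  setIntegral_nonneg measurableSet_Ioi fun _ hu =>
    div_nonneg (sq_nonneg _) (hx.trans (le_of_lt hu))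

lemma continuousOn_decayIntegral
    (hF : ∀ x > 0, IntegrableOn (fun u => φ (4 / u) ^ 2 / u) (Ioi x)) :
    ContinuousOn (decayIntegral φ) (Ioi 0) := by
  intro x hx
  have hx' : (0 : ℝ) < x := hx
  have h := (hF (x / 2) (half_pos hx')).continuousOn_Ici_primitive_Ioi
  exact (h.continuousAt (Ici_mem_nhds (half_lt_self hx'))).continuousWithinAt

/-- Each dyadic interval below 1 contributes at least `φ 4 ^ 2 / 2`, so `F` is unbounded near 0. -/
lemma le_decayIntegral_pow (hφ_pos : ∀ x > 0, 0 < φ x) (hφ_mono : MonotoneOn φ (Ioi 0))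
    (hF : ∀ x > 0, IntegrableOn (fun u => φ (4 / u) ^ 2 / u) (Ioi x)) (n : ℕ) :
    n * (φ 4 ^ 2 / 2) ≤ decayIntegral φ ((1 / 2) ^ n) := by
  induction n with
  | zero => simpa using decayIntegral_nonneg φ zero_le_one
  | succ n ih =>
    set b : ℝ := (1 / 2) ^ n with hb
    have hb0 : 0 < b := by positivity
    have hb1 : b ≤ 1 := pow_le_one₀ (by norm_num) (by norm_num)
    have h := le_decayIntegral_sub hφ_pos hφ_mono hF (a := b * (1 / 2)) (b := b) (by positivity)
      (by linarith)
    have h1 : φ (4 / b) ^ 2 / b * (b - b * (1 / 2)) = φ (4 / b) ^ 2 / 2 := by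
      field_simp
      ring
    have h2 : φ 4 ≤ φ (4 / b) := hφ_mono (by norm_num) (by simpa using hb0)
      (by rw [le_div_iff₀ hb0]; linarith)
    have h3 : φ 4 ^ 2 ≤ φ (4 / b) ^ 2 := pow_le_pow_left₀ (hφ_pos 4 (by norm_num)).le h2 2
    rw [pow_succ (1 / 2 : ℝ) n, ← hb]
    push_cast
    linarith

theorem bijOn_decayIntegral (hφ_pos : ∀ x > 0, 0 < φ x) (hφ_mono : MonotoneOn φ (Ioi 0))
    (hF : ∀ x > 0, IntegrableOn (fun u => φ (4 / u) ^ 2 / u) (Ioi x)) :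
    BijOn (decayIntegral φ) (Ioi 0) (Ioi 0) := by
  have hanti := strictAntiOn_decayIntegral hφ_pos hφ_mono hF
  refine ⟨fun x hx => ?_, hanti.injOn, fun y hy => ?_⟩
  · have hx' : (0 : ℝ) < x := hx
    have h1 : x + 1 ∈ Ioi (0 : ℝ) := by
      simp only [mem_Ioi]
      linarith
    exact (decayIntegral_nonneg φ (le_of_lt h1)).trans_lt (hanti hx h1 (lt_add_one x))
  · have hy' : (0 : ℝ) < y := hy
    have hφ4 := hφ_pos 4 (by norm_num)
    obtain ⟨n, hn⟩ := exists_nat_gt (y / (φ 4 ^ 2 / 2))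
    rw [div_lt_iff₀ (by positivity)] at hn
    have hlim : Tendsto (decayIntegral φ) atTop (𝓝 0) :=
      tendsto_integral_Ioi_zero tendsto_id
    obtain ⟨b, hb, hb0⟩ := ((hlim.eventually_lt_const hy').and (eventually_gt_atTop 0)).exists
    exact isPreconnected_Ioi.intermediate_value hb0
      (show (1 / 2 : ℝ) ^ n ∈ Ioi 0 by simp) (continuousOn_decayIntegral hF)
      ⟨hb.le, hn.le.trans (le_decayIntegral_pow hφ_pos hφ_mono hF n)⟩

/-- A differential inequality for `u` in terms of the integrand of `F` bounds `F ∘ u` from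
below. -/
lemma mul_le_decayIntegral (hφ_pos : ∀ x > 0, 0 < φ x) (hφ_mono : MonotoneOn φ (Ioi 0))
    (hF : ∀ x > 0, IntegrableOn (fun u => φ (4 / u) ^ 2 / u) (Ioi x)) {u u' : ℝ → ℝ} {c T : ℝ}
    (hc : 0 < c) (hT : 0 ≤ T) (hu : ∀ s ∈ Icc 0 T, HasDerivAt u (u' s) s)
    (hpos : ∀ s ∈ Icc 0 T, 0 < u s)
    (hcu : ∀ s ∈ Icc 0 T, φ (4 / u s) ^ 2 / u s * u' s ≤ -c) :
    c * T ≤ decayIntegral φ (u T) := by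
  have hcont : ContinuousOn u (Icc 0 T) := fun s hs => (hu s hs).continuousAt.continuousWithinAt
  -- `F ∘ u` need not be differentiable, so it is compared with a linear function through right
  -- slopes only.
  have h := image_le_of_liminf_slope_right_le_deriv_boundary
    (f := fun s => -decayIntegral φ (u s)) (a := 0) (b := T)
    (B := fun s => -c * s) (B' := fun _ => -c)
    ((continuousOn_decayIntegral hF).comp hcont hpos).neg
    (by
      simp only [mul_zero]
      exact neg_nonpos.2 (decayIntegral_nonneg φ (hpos 0 ⟨le_rfl, hT⟩).le))
    (by fun_prop)
    (fun s _ => by simpa using ((hasDerivAt_id s).const_mul (-c)).hasDerivWithinAt)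
    (fun s hs r hr => ?_) (right_mem_Icc.2 hT)
  · linarith
  · have hs' : s ∈ Icc 0 T := Ico_subset_Icc_self hs
    have hus := hpos s hs'
    have hφs := hφ_pos (4 / u s) (by positivity)
    set w := φ (4 / u s) ^ 2 / u s with hw
    have hw0 : 0 < w := by positivity
    have hder := hcu s hs'
    have hneg : u' s < 0 := by
      by_contra h0
      have := mul_nonneg hw0.le (not_lt.1 h0)
      linarith
    have hslope := (hasDerivAt_iff_tendsto_slope.1 (hu s hs')).mono_left
      (nhdsWithin_mono s fun z (hz : z ∈ Ioi s) => ne_of_gt hz)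
    refine Eventually.frequently ?_
    filter_upwards [hslope.eventually_lt_const hneg,
      (hslope.const_mul w).eventually_lt_const (hder.trans_lt hr),
      Ioo_mem_nhdsGT hs.2] with z hz1 hz2 hz3
    have hzs : 0 < z - s := sub_pos.2 hz3.1
    have hz4 := hpos z ⟨hs.1.trans hz3.1.le, hz3.2.le⟩
    rw [slope_def_field] at hz1 hz2 ⊢
    have hz5 : u z ≤ u s := by
      by_contra h0
      exact (div_nonneg (sub_nonneg.2 (not_le.1 h0).le) hzs.le).not_gt hz1
    have h1 := le_decayIntegral_sub hφ_pos hφ_mono hF hz4 hz5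
    refine lt_of_le_of_lt ?_ hz2
    rw [← mul_div_assoc]
    refine div_le_div_of_nonneg_right ?_ hzs.le
    linarith

end DecayIntegral

namespace MetricGraph

/-! ### The upper bound -/

section UpperBound

variable {V E : Type*} {G : MetricGraph V E} {φ : ℝ → ℝ}

lemma sum_finKernel_sq (D : Finset V) (x : V) (s : ℝ) :
    ∑ v ∈ D, G.finKernel D x v s ^ 2 * G.vol v = G.finKernel D x x (2 * s) := by
  rw [← G.sum_finKernel_mul D x x s (2 * s)]
  refine Finset.sum_congr rfl fun v _ => ?_
  rw [show 2 * s - s = s by ring, sq]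

lemma hasDerivAt_sum_finKernel_sq (D : Finset V) (x : V) (s : ℝ) :
    HasDerivAt (fun s => ∑ v ∈ D, G.finKernel D x v s ^ 2 * G.vol v)
      (-(2 * G.energy D fun v => G.finKernel D x v s)) s := by
  have hu := G.isHeatFlow_finKernel D x
  have h1 : HasDerivAt (fun s => ∑ v ∈ D, G.finKernel D x v s ^ 2 * G.vol v)
      (∑ v ∈ D, (((2 : ℕ) : ℝ) * G.finKernel D x v s ^ (2 - 1) *
        -G.laplacian (fun z => G.finKernel D x z s) v) * G.vol v) s :=
    HasDerivAt.fun_sum fun v hv => ((hu.hasDerivAt v hv s).fun_pow 2).mul_const _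
  convert h1 using 1
  rw [← G.sum_self_mul_laplacian fun v hv => hu.eq_zero v hv s, Finset.mul_sum,
    ← Finset.sum_neg_distrib]
  refine Finset.sum_congr rfl fun v _ => ?_
  push_cast
  ring

/-- If the kernel exceeded `y` at time `t`, then `u`, being nonincreasing, would be positive on `[0,
t/2]`, where Nash's inequality applies and forces `F` at the kernel to be at least `F y`. This
contradicts strict decrease; `x ∉ D` needs no separate case. -/
theorem Isoperimetric.finKernel_le [Nonempty E] (hiso : G.Isoperimetric φ)
    (hρ : BddAbove (range G.halfDegree)) (hφ_pos : ∀ x > 0, 0 < φ x)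
    (hφ_mono : MonotoneOn φ (Ioi 0))
    (hF : ∀ x > 0, MeasureTheory.IntegrableOn (fun u => φ (4 / u) ^ 2 / u) (Ioi x))
    {D : Finset V} (hD : ∀ v ∈ D, v ∉ G.bdry) (x : V) {t y : ℝ} (ht : 0 < t) (hy : 0 < y)
    (hyt : decayIntegral φ y ≤ t / (8 * G.rhoSup)) : G.finKernel D x x t ≤ y := by
  by_contra hlt
  rw [not_le] at hlt
  have hρ0 := rhoSup_pos hρ
  set u : ℝ → ℝ := fun s => ∑ v ∈ D, G.finKernel D x v s ^ 2 * G.vol v with hu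
  have hut : u (t / 2) = G.finKernel D x x t := by
    simp only [hu]
    rw [sum_finKernel_sq, mul_div_cancel₀ _ two_ne_zero]
  have hder := hasDerivAt_sum_finKernel_sq (G := G) D x
  have hanti : Antitone u := antitone_of_deriv_nonpos (fun s => (hder s).differentiableAt)
    fun s => by
      rw [(hder s).deriv]
      have := G.energy_nonneg D fun v => G.finKernel D x v s
      linarith
  have hpos : ∀ s ∈ Icc 0 (t / 2), 0 < u s := fun s hs =>
    (hy.trans hlt).trans_le (hut.symm.trans_le (hanti hs.2))
  have h := mul_le_decayIntegral hφ_pos hφ_mono hF (u := u) (c := 1 / (4 * G.rhoSup))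
    (T := t / 2) (by positivity) (by positivity) (fun s _ => hder s) hpos fun s hs => by
      have hus := hpos s hs
      have hφs := hφ_pos (4 / u s) (by positivity)
      have hnash := hiso.nash hφ_pos hφ_mono hρ hD (f := fun v => G.finKernel D x v s)
        (fun v => G.finKernel_nonneg D x v hs.1)
        (fun v hv => (G.isHeatFlow_finKernel D x).eq_zero v hv s)
        (G.sum_finKernel_le_one D x hs.1) hus
      change u s ≤ 8 * G.rhoSup * φ (4 / u s) ^ 2 * _ at hnash
      rw [mul_neg, neg_le_neg_iff, div_mul_eq_mul_div, div_le_div_iff₀ (by positivity) hus]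
      linarith
  rw [hut] at h
  have h1 := strictAntiOn_decayIntegral hφ_pos hφ_mono hF hy (hy.trans hlt) hlt
  have h2 : 1 / (4 * G.rhoSup) * (t / 2) = t / (8 * G.rhoSup) := by
    field_simp
    norm_num
  linarith

end UpperBound

end MetricGraph

theorem mainTheorem10 {V E : Type*} [Nonempty E] (G : MetricGraph V E)
    (hρ : BddAbove (Set.range G.halfDegree))
    (φ : ℝ → ℝ) (hφ_pos : ∀ x > 0, 0 < φ x) (hφ_mono : MonotoneOn φ (Set.Ioi 0))
    (hF : ∀ x > 0, MeasureTheory.IntegrableOn (fun u => φ (4 / u) ^ 2 / u) (Set.Ioi x))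
    (hiso : G.Isoperimetric φ) :
    Set.BijOn (decayIntegral φ) (Set.Ioi 0) (Set.Ioi 0) ∧
    (∃ K : V → V → ℝ → ℝ, G.IsMinimalHeatKernel K) ∧
    ∀ K : V → V → ℝ → ℝ, G.IsMinimalHeatKernel K → ∀ x : V, ∀ t > 0,
      K x x t ≤ Function.invFunOn (decayIntegral φ) (Set.Ioi 0) (t / (32 * G.rhoSup)) := by
  have hbij := bijOn_decayIntegral hφ_pos hφ_mono hF
  have hmin := G.isMinimalHeatKernel_heatKernel
  refine ⟨hbij, ⟨_, hmin⟩, fun K hK x t ht => ?_⟩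
  have hρ0 := MetricGraph.rhoSup_pos hρ
  have himg : t / (32 * G.rhoSup) ∈ decayIntegral φ '' Ioi 0 :=
    hbij.surjOn (show 0 < t / (32 * G.rhoSup) by positivity)
  have hy := Function.invFunOn_mem himg
  have hFy := Function.invFunOn_eq himg
  -- Minimality puts any such `K` below the constructed kernel, a supremum of finite kernels that
  -- obey the bound.
  refine (hK.minimal _ hmin.toIsFundamentalSolution hmin.nonneg x x t ht.le).trans
    (ciSup_le fun S => ?_)
  refine hiso.finKernel_le hρ hφ_pos hφ_mono hF (fun v hv => (G.mem_interiorPart.1 hv).2) x ht hy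
    (hFy.trans_le ?_)
  -- The finite bound needs only `8 * G.rhoSup`; the stated 32 leaves a factor of four.
  exact div_le_div_of_nonneg_left ht.le (by positivity) (by linarith)
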